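/- Consider a two-player Markov game with finite state space $S$, finite action sets $A_1$ (leader) and $A_2$ (follower), rewards $r_k(s,a_1,a_2)\in\mathbb R$ ($k=1,2$), transition probabilities $p(s'\mid s,a_1,a_2)$ and discount factor $0\le\gamma<1$. Let $(s^t,a_1^t,a_2^t)_{t\ge 0}$ be a random play of the game, adapted to a filtration $(\mathcal F_t)_{t\ge0}$: $s^t,a_1^t,a_2^t$ are $\mathcal F_t$-measurable, and conditionally on $\mathcal F_t$ the next state $s^{t+1}$ has distribution $p(\cdot\mid s^t,a_1^t,a_2^t)$; the actions may be chosen from the past in any way. Starting from any $\mathcal F_0$-measurable tables $(Q_1^0,Q_2^0)$, let $Q^t=(Q_1^t,Q_2^t)$, with $Q_k^t:S\times A_1\times A_2\to\mathbb R$, be generated as follows. At step $t$, with $s'=s^{t+1}$, choose $$a_1'\in\arg\max_{a_1}Q_1^t\bigl(s',a_1,\arg\max_{a_2}Q_2^t(s',a_1,a_2)\bigr),\qquad a_2'\in\arg\max_{a_2}Q_2^t(s',a_1',a_2),$$ with ties broken in any way, and put, for $k=1,2$ and all $(s,a_1,a_2)$, $$Q_k^{t+1}(s,a_1,a_2)=(1-\alpha^t(s,a_1,a_2))\,Q_k^t(s,a_1,a_2)+\alpha^t(s,a_1,a_2)\bigl(r_k(s,a_1,a_2)+\gamma\,Q_k^t(s',a_1',a_2')\bigr).$$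 Assume: 1. With probability 1, every triple $(s,a_1,a_2)\in S\times A_1\times A_2$ is visited infinitely often. 2. The learning rates $\alpha^t(s,a_1,a_2)\in[0,1)$ are $\mathcal F_t$-measurable, with $\alpha^t(s,a_1,a_2)=0$ unless $(s,a_1,a_2)=(s^t,a_1^t,a_2^t)$; and with probability 1, for all $(s,a_1,a_2)$, $\sum_t\alpha^t(s,a_1,a_2)=\infty$ and $\sum_t[\alpha^t(s,a_1,a_2)]^2<\infty$. 3. With probability 1, for all $t$ and $s$ the stage game $(Q_1^t(s,\cdot,\cdot),Q_2^t(s,\cdot,\cdot))$ has a global optimal point, that is, a joint action at which both players simultaneously receive their highest payoffs, and the payoffs $Q_k^t(s',a_1',a_2')$, $k=1,2$, used in the update at step $t$ are the payoffs at a global optimal point of the stage game at $s'=s^{t+1}$. Then there is a (non-random) pair $Q^*=(Q_1^*,Q_2^*)$ such that $Q^t\to Q^*$ with probability 1, and $Q^*$ solves the bi-level Bellman equation: there is a choice, for every state $s'$, of a Stackelberg equilibrium $(\pi_1(s'),\pi_2(s'))$ of the stage game $(Q_1^*(s',\cdot,\cdot),Q_2^*(s',\cdot,\cdot))$ such that for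 $k=1,2$ and all $(s,a_1,a_2)$ $$Q_k^*(s,a_1,a_2)=r_k(s,a_1,a_2)+\gamma\sum_{s'\in S}p(s'\mid s,a_1,a_2)\,Q_k^*(s',\pi_1(s'),\pi_2(s')).$$ Here $(a_1^*,a_2^*)$ is a Stackelberg equilibrium of a matrix game $(u_1,u_2)$ if there is a map $b:A_1\to A_2$ with $b(a_1)\in\arg\max_{a_2}u_2(a_1,a_2)$ for all $a_1$, $a_1^*\in\arg\max_{a_1}u_1(a_1,b(a_1))$ and $a_2^*=b(a_1^*)$. -/

import Mathlib

open Filter Topology MeasureTheory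

/-- A finite two-player Markov game with discount factor. The players are indexed by `Fin 2`:
`0` is the leader, with actions in `A₁`, and `1` is the follower, with actions in `A₂`.
`trans x a₁ a₂ x'` is the probability of moving from `x` to `x'` under `(a₁, a₂)`. -/
structure MarkovGame (S A₁ A₂ : Type*) [Fintype S] where
  reward : Fin 2 → S → A₁ → A₂ → ℝ
  trans : S → A₁ → A₂ → S → ℝ
  trans_nonneg : ∀ x a₁ a₂ x', 0 ≤ trans x a₁ a₂ x'
  trans_sum : ∀ x a₁ a₂, ∑ x', trans x a₁ a₂ x' = 1
  γ : ℝ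
  γ_nonneg : 0 ≤ γ
  γ_lt_one : γ < 1

/-- A pair of Q-tables `(Q₁, Q₂)`; `Q k x` is the payoff matrix of player `k` in the stage game at
state `x`. For finite `S`, `A₁`, `A₂` the topology is that of the maximum norm. -/
abbrev QPair (S A₁ A₂ : Type*) : Type _ := Fin 2 → S → A₁ → A₂ → ℝ

section StageGame

variable {A₁ A₂ : Type*}

/-- `b` selects, for every action of the leader, a maximizer of the follower's payoff:
`b a₁ ∈ argmax_{a₂} u₂(a₁, a₂)`. -/
def IsBestResponse (u₂ : A₁ → A₂ → ℝ) (b : A₁ → A₂) : Prop :=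
  ∀ a₁ a₂, u₂ a₁ a₂ ≤ u₂ a₁ (b a₁)

/-- The two selection steps of the update: `a₁ ∈ argmax_{a} u₁(a, argmax_{a'} u₂(a, a'))`, followed
by `a₂ ∈ argmax_{a'} u₂(a₁, a')`. Ties in each `argmax` may be broken in any way. -/
def IsBilevelChoice (u₁ u₂ : A₁ → A₂ → ℝ) (a₁ : A₁) (a₂ : A₂) : Prop :=
  (∃ b, IsBestResponse u₂ b ∧ ∀ a, u₁ a (b a) ≤ u₁ a₁ (b a₁)) ∧
    ∀ a', u₂ a₁ a' ≤ u₂ a₁ a₂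

/-- `(a₁, a₂)` is a (pure) Stackelberg equilibrium of the matrix game `(u₁, u₂)`: for some best
response map `b` of the follower, `a₁` maximizes `u₁(a, b a)` over `a`, and `a₂ = b a₁`. -/
def IsStackelberg (u₁ u₂ : A₁ → A₂ → ℝ) (a₁ : A₁) (a₂ : A₂) : Prop :=
  ∃ b, IsBestResponse u₂ b ∧ (∀ a, u₁ a (b a) ≤ u₁ a₁ (b a₁)) ∧ b a₁ = a₂

/-- `(a₁, a₂)` is a global optimal point: every player receives its highest payoff there. -/
def IsGlobalOptimal (u : Fin 2 → A₁ → A₂ → ℝ) (a₁ : A₁) (a₂ : A₂) : Prop :=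
  ∀ k a₁' a₂', u k a₁' a₂' ≤ u k a₁ a₂

end StageGame

section Learning

variable {S A₁ A₂ Ω : Type*} [Fintype S] {m : MeasurableSpace Ω}

/-- The bi-level Bellman equation: `Q_k(x, a) = r_k(x, a) + γ ∑_{x'} p(x' | x, a) V_k(x')`, where
`V_k(x')` is the payoff of player `k` in a Stackelberg equilibrium `(π₁ x', π₂ x')` of the stage
game `(Q₁(x'), Q₂(x'))`, the same one for both players. -/
def SolvesBilevelBellman (G : MarkovGame S A₁ A₂) (Q : QPair S A₁ A₂) : Prop :=
  ∃ (π₁ : S → A₁) (π₂ : S → A₂),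
    (∀ x, IsStackelberg (Q 0 x) (Q 1 x) (π₁ x) (π₂ x)) ∧
    ∀ k x a₁ a₂, Q k x a₁ a₂ =
      G.reward k x a₁ a₂ + G.γ * ∑ x', G.trans x a₁ a₂ x' * Q k x' (π₁ x') (π₂ x')

/-- `(s t, a₁ t, a₂ t)` is the process of states and joint actions of a play of `G`, adapted to `ℱ`.
Given the history `ℱ t`, which includes the current state and actions, the next state has
distribution `G.trans (s t) (a₁ t) (a₂ t)`. The actions may be chosen in any way from the past. -/
structure IsPlay (G : MarkovGame S A₁ A₂) (μ : Measure Ω) (ℱ : Filtration ℕ m)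
    (s : ℕ → Ω → S) (a₁ : ℕ → Ω → A₁) (a₂ : ℕ → Ω → A₂) : Prop where
  state_adapted : ∀ t x, MeasurableSet[ℱ t] {ω | s t ω = x}
  action₁_adapted : ∀ t a, MeasurableSet[ℱ t] {ω | a₁ t ω = a}
  action₂_adapted : ∀ t a, MeasurableSet[ℱ t] {ω | a₂ t ω = a}
  transition : ∀ t x',
    μ[Set.indicator {ω | s (t + 1) ω = x'} (fun _ => (1 : ℝ)) | ℱ t] =ᵐ[μ]
      fun ω => G.trans (s t ω) (a₁ t ω) (a₂ t ω) x'

/-- `Q` is a run of tabular bi-level Q-learning along the states `s` with learning rates `α`: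
`(b₁ t, b₂ t)` is the joint action chosen in the next state `s (t + 1)` from the current tables,
and both tables are moved towards the target `r_k + γ Q_k(s', b₁, b₂)`. -/
structure IsBilevelQRun (G : MarkovGame S A₁ A₂) (ℱ : Filtration ℕ m)
    (s : ℕ → Ω → S) (α : ℕ → Ω → S → A₁ → A₂ → ℝ)
    (b₁ : ℕ → Ω → A₁) (b₂ : ℕ → Ω → A₂) (Q : ℕ → Ω → QPair S A₁ A₂) : Prop where
  initial : ∀ k x y z, Measurable[ℱ 0] fun ω => Q 0 ω k x y z
  choice : ∀ t ω,
    IsBilevelChoice (Q t ω 0 (s (t + 1) ω)) (Q t ω 1 (s (t + 1) ω)) (b₁ t ω) (b₂ t ω)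
  update : ∀ t ω k x y z, Q (t + 1) ω k x y z =
    (1 - α t ω x y z) * Q t ω k x y z +
      α t ω x y z * (G.reward k x y z + G.γ * Q t ω k (s (t + 1) ω) (b₁ t ω) (b₂ t ω))

/-- Every state and joint action is visited infinitely often, almost surely. -/
def VisitedInfinitelyOften (μ : Measure Ω)
    (s : ℕ → Ω → S) (a₁ : ℕ → Ω → A₁) (a₂ : ℕ → Ω → A₂) : Prop :=
  ∀ᵐ ω ∂μ, ∀ x y z, ∃ᶠ t in atTop, s t ω = x ∧ a₁ t ω = y ∧ a₂ t ω = z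

/-- The learning rates: `α t` is determined by the history up to time `t`, lies in `[0, 1)`,
satisfies the Robbins–Monro conditions almost surely, and vanishes at all entries of the table
except the one currently visited. -/
structure IsLearningRate (μ : Measure Ω) (ℱ : Filtration ℕ m)
    (s : ℕ → Ω → S) (a₁ : ℕ → Ω → A₁) (a₂ : ℕ → Ω → A₂)
    (α : ℕ → Ω → S → A₁ → A₂ → ℝ) : Prop where
  adapted : ∀ t x y z, Measurable[ℱ t] fun ω => α t ω x y z
  nonneg : ∀ t ω x y z, 0 ≤ α t ω x y z
  lt_one : ∀ t ω x y z, α t ω x y z < 1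
  sum_eq_top : ∀ᵐ ω ∂μ, ∀ x y z,
    Tendsto (fun n => ∑ t ∈ Finset.range n, α t ω x y z) atTop atTop
  sum_sq_lt_top : ∀ᵐ ω ∂μ, ∀ x y z, Summable fun t => α t ω x y z ^ 2
  eq_zero : ∀ t ω x y z, (x, y, z) ≠ (s t ω, a₁ t ω, a₂ t ω) → α t ω x y z = 0

/-- Almost surely, every stage game `(Q₁^t(x), Q₂^t(x))` has a global optimal point, and the payoffs
used in the update (those at `(b₁ t, b₂ t)` in state `s (t + 1)`) are the payoffs at such a
point. -/
def SelectsGlobalOptimum (μ : Measure Ω) (s : ℕ → Ω → S)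
    (b₁ : ℕ → Ω → A₁) (b₂ : ℕ → Ω → A₂) (Q : ℕ → Ω → QPair S A₁ A₂) : Prop :=
  ∀ᵐ ω ∂μ, ∀ t,
    (∀ x, ∃ y z, IsGlobalOptimal (fun k => Q t ω k x) y z) ∧
    ∃ y z, IsGlobalOptimal (fun k => Q t ω k (s (t + 1) ω)) y z ∧
      ∀ k, Q t ω k (s (t + 1) ω) (b₁ t ω) (b₂ t ω) = Q t ω k (s (t + 1) ω) y z

end Learning

/-! At a global optimal point each player receives the maximum of its own table, so the update
decouples: along almost every path each `Q k` is ordinary Q-learning for the decision process in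
which one agent controls the joint action (`hQ`). Its limit is a fixed point of the Bellman
optimality operator, a max-norm contraction. Convergence (`tendsto_qLearning`) splits the error into
averaged noise and a remainder. The noise vanishes because its weighted series is an almost surely
convergent martingale transform (`ae_exists_tendsto_sum_mul`); the remainder is then shrunk
repeatedly by a factor below one (`tendsto_of_asynchronous_contraction`). Global optimal points
survive in the limit (`exists_isGlobalOptimal_of_tendsto`) and are Stackelberg equilibria attaining
both maxima, so the two separate optimality equations become one bi-level equation. -/

/-! ### Deterministic averaging recursions and asynchronous contraction. -/

/-- Each step multiplies the excess over `c` by at most `1 - a t ≤ exp (-a t)`, and the exponents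
have divergent sum. -/
theorem eventually_abs_le_of_averaging {a d e : ℕ → ℝ} {c ε : ℝ}
    (ha₀ : ∀ t, 0 ≤ a t) (ha₁ : ∀ t, a t ≤ 1)
    (hsum : Tendsto (fun n => ∑ t ∈ Finset.range n, a t) atTop atTop)
    (hd : ∀ t, d (t + 1) = (1 - a t) * d t + a t * e t)
    (he : ∀ᶠ t in atTop, |e t| ≤ c) (hε : 0 < ε) :
    ∀ᶠ t in atTop, |d t| ≤ c + ε := by
  obtain ⟨T, hT⟩ := eventually_atTop.1 he
  -- Clipping at zero makes the bound nonnegative, as replacing `1 - a` by `exp (-a)` requires.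
  set K := max (|d T| - c) 0 with hK
  have hK0 : 0 ≤ K := le_max_right _ _
  have key : ∀ n, |d (T + n)| - c ≤ K * Real.exp (-∑ i ∈ Finset.range n, a (T + i)) := by
    intro n
    induction n with
    | zero => simp [hK]
    | succ n ih =>
      have h1 : |d (T + n + 1)| ≤ (1 - a (T + n)) * |d (T + n)| + a (T + n) * c := by
        rw [hd]
        refine (abs_add_le _ _).trans ?_
        rw [abs_mul, abs_mul, abs_of_nonneg (ha₀ _), abs_of_nonneg (sub_nonneg.2 (ha₁ _))]
        have := mul_le_mul_of_nonneg_left (hT (T + n) (by omega)) (ha₀ (T + n))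
        linarith
      have h2 : 1 - a (T + n) ≤ Real.exp (-a (T + n)) := Real.one_sub_le_exp_neg _
      have h3 : 0 ≤ K * Real.exp (-∑ i ∈ Finset.range n, a (T + i)) := by positivity
      rw [Finset.sum_range_succ, neg_add, Real.exp_add, ← mul_assoc, ← add_assoc]
      calc |d (T + n + 1)| - c ≤ (1 - a (T + n)) * (|d (T + n)| - c) := by linarith
        _ ≤ (1 - a (T + n)) * (K * Real.exp (-∑ i ∈ Finset.range n, a (T + i))) :=
          mul_le_mul_of_nonneg_left ih (sub_nonneg.2 (ha₁ _))
        _ ≤ _ := by rw [mul_comm]; exact mul_le_mul_of_nonneg_left h2 h3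
  have hsum' : Tendsto (fun n => ∑ i ∈ Finset.range n, a (T + i)) atTop atTop := by
    have h := tendsto_atTop_add_const_right atTop (-∑ i ∈ Finset.range T, a i)
      (hsum.comp (tendsto_add_atTop_nat T))
    refine h.congr fun n => ?_
    simp only [Function.comp_apply]
    rw [add_comm n T, Finset.sum_range_add]
    ring
  have hlim : Tendsto (fun n => K * Real.exp (-∑ i ∈ Finset.range n, a (T + i))) atTop (𝓝 0) := by
    simpa using (Real.tendsto_exp_neg_atTop_nhds_zero.comp hsum').const_mul K
  obtain ⟨n₀, hn₀⟩ := eventually_atTop.1 (hlim.eventually_le_const hε)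
  refine eventually_atTop.2 ⟨T + n₀, fun t ht => ?_⟩
  obtain ⟨n, rfl⟩ := Nat.exists_eq_add_of_le (le_trans (Nat.le_add_right T n₀) ht)
  have := hn₀ n (by omega)
  linarith [key n]

theorem tendsto_zero_of_averaging {a d e : ℕ → ℝ}
    (ha₀ : ∀ t, 0 ≤ a t) (ha₁ : ∀ t, a t ≤ 1)
    (hsum : Tendsto (fun n => ∑ t ∈ Finset.range n, a t) atTop atTop)
    (hd : ∀ t, d (t + 1) = (1 - a t) * d t + a t * e t)
    (he : Tendsto e atTop (𝓝 0)) : Tendsto d atTop (𝓝 0) := by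
  rw [Metric.tendsto_atTop']
  intro ε hε
  have h1 : ∀ᶠ t in atTop, |e t| ≤ ε / 3 :=
    (tendsto_zero_iff_abs_tendsto_zero _ |>.1 he).eventually_le_const (by positivity)
  obtain ⟨T, hT⟩ := eventually_atTop.1
    (eventually_abs_le_of_averaging ha₀ ha₁ hsum hd h1 (show 0 < ε / 3 by positivity))
  refine ⟨T, fun n hn => ?_⟩
  rw [Real.dist_0_eq_abs]
  linarith [hT n hn.le]

/-- Averaged noise vanishes if the weighted noise has a convergent series. -/
theorem tendsto_zero_of_averaging_noise {a N w : ℕ → ℝ} {l : ℝ}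
    (ha₀ : ∀ t, 0 ≤ a t) (ha₁ : ∀ t, a t ≤ 1)
    (hsum : Tendsto (fun n => ∑ t ∈ Finset.range n, a t) atTop atTop)
    (hN : ∀ t, N (t + 1) = (1 - a t) * N t + a t * w t)
    (hw : Tendsto (fun n => ∑ t ∈ Finset.range n, a t * w t) atTop (𝓝 l)) :
    Tendsto N atTop (𝓝 0) := by
  have h0 : Tendsto (fun n => (∑ t ∈ Finset.range n, a t * w t) - l) atTop (𝓝 0) := by
    simpa using hw.sub_const l
  -- The increment `a t * w t` cancels in this difference, leaving an averaging recursion driven by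
  -- the vanishing tail of the series.
  have h1 : Tendsto (fun n => N n - ((∑ t ∈ Finset.range n, a t * w t) - l)) atTop (𝓝 0) := by
    refine tendsto_zero_of_averaging ha₀ ha₁ hsum
      (e := fun n => -((∑ t ∈ Finset.range n, a t * w t) - l)) (fun t => ?_) (by simpa using h0.neg)
    rw [hN, Finset.sum_range_succ]
    ring
  simpa using h1.add h0

/-- The averaged noise process started at zero. -/
noncomputable def averagedNoise (a w : ℕ → ℝ) : ℕ → ℝ
  | 0 => 0
  | t + 1 => (1 - a t) * averagedNoise a w t + a t * w t

/-- Asynchronous stochastic approximation of the fixed point of a maximum-norm contraction, along a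
single bounded trajectory. -/
theorem tendsto_of_asynchronous_contraction {ι : Type*} [Fintype ι]
    {H : (ι → ℝ) → ι → ℝ} {γ B : ℝ} {p : ι → ℝ} {α w q : ℕ → ι → ℝ}
    (hγ₀ : 0 ≤ γ) (hγ₁ : γ < 1)
    (hH : ∀ u c, (∀ x, |u x - p x| ≤ c) → ∀ x, |H u x - p x| ≤ γ * c)
    (hα₀ : ∀ t x, 0 ≤ α t x) (hα₁ : ∀ t x, α t x ≤ 1)
    (hsum : ∀ x, Tendsto (fun n => ∑ t ∈ Finset.range n, α t x) atTop atTop)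
    (hq : ∀ t x, q (t + 1) x = (1 - α t x) * q t x + α t x * (H (q t) x + w t x))
    (hB : ∀ t x, |q t x| ≤ B)
    (hw : ∀ x, ∃ l, Tendsto (fun n => ∑ t ∈ Finset.range n, α t x * w t x) atTop (𝓝 l)) :
    Tendsto q atTop (𝓝 p) := by
  set N : ℕ → ι → ℝ := fun t x => averagedNoise (fun t => α t x) (fun t => w t x) t with hNdef
  have hN : ∀ x, Tendsto (fun t => N t x) atTop (𝓝 0) := fun x => by
    obtain ⟨l, hl⟩ := hw x
    exact tendsto_zero_of_averaging_noise (fun t => hα₀ t x) (fun t => hα₁ t x) (hsum x)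
      (fun t => rfl) hl
  have hNle : ∀ ε > 0, ∀ᶠ t in atTop, ∀ x, |N t x| ≤ ε := fun ε hε =>
    eventually_all.2 fun x =>
      (tendsto_zero_iff_abs_tendsto_zero _ |>.1 (hN x)).eventually_le_const hε
  set Y : ℕ → ι → ℝ := fun t x => q t x - p x - N t x with hYdef
  have hY : ∀ t x, Y (t + 1) x = (1 - α t x) * Y t x + α t x * (H (q t) x - p x) := by
    intro t x
    have : N (t + 1) x = (1 - α t x) * N t x + α t x * w t x := rfl
    simp only [hYdef]
    rw [this, hq]
    ring
  -- With slack `δ = (1 - γ) / 4 * c`, spent once on the noise and once on the averaging, `γ * (c +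
  -- δ) + δ ≤ ρ * c`.
  set ρ := (1 + γ) / 2 with hρ
  have step : ∀ c > 0, (∀ᶠ t in atTop, ∀ x, |Y t x| ≤ c) →
      ∀ᶠ t in atTop, ∀ x, |Y t x| ≤ ρ * c := by
    intro c hc h
    have hδ : 0 < (1 - γ) / 4 * c := mul_pos (by linarith) hc
    refine eventually_all.2 fun x => ?_
    have he : ∀ᶠ t in atTop, |H (q t) x - p x| ≤ γ * (c + (1 - γ) / 4 * c) := by
      filter_upwards [h, hNle _ hδ] with t h1 h2
      refine hH _ _ (fun y => ?_) x
      have : q t y - p y = Y t y + N t y := by simp only [hYdef]; ring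
      rw [this]
      exact (abs_add_le _ _).trans (add_le_add (h1 y) (h2 y))
    filter_upwards [eventually_abs_le_of_averaging (fun t => hα₀ t x) (fun t => hα₁ t x) (hsum x)
      (d := fun t => Y t x) (fun t => hY t x) he hδ] with t ht
    refine ht.trans ?_
    have : γ * ((1 - γ) / 4 * c) ≤ 1 * ((1 - γ) / 4 * c) :=
      mul_le_mul_of_nonneg_right hγ₁.le hδ.le
    rw [hρ]
    linarith
  set C := |B| + ∑ x, |p x| + 1 with hC
  have hC0 : 0 < C := by positivity
  have base : ∀ᶠ t in atTop, ∀ x, |Y t x| ≤ C := by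
    filter_upwards [hNle 1 one_pos] with t ht x
    have h1 : |p x| ≤ ∑ x, |p x| :=
      Finset.single_le_sum (f := fun x => |p x|) (fun _ _ => abs_nonneg _) (Finset.mem_univ x)
    have h2 := (abs_sub (q t x - p x) (N t x)).trans
      (add_le_add_left (abs_sub (q t x) (p x)) _)
    linarith [hB t x, ht x, le_abs_self B]
  have iter : ∀ n : ℕ, ∀ᶠ t in atTop, ∀ x, |Y t x| ≤ ρ ^ n * C := by
    intro n
    induction n with
    | zero => simpa using base
    | succ n ih =>
      have hpos : 0 < ρ ^ n * C := mul_pos (pow_pos (by linarith) n) hC0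
      simpa [pow_succ', mul_assoc] using step _ hpos ih
  rw [tendsto_pi_nhds]
  intro x
  have hYx : Tendsto (fun t => Y t x) atTop (𝓝 0) := by
    rw [Metric.tendsto_nhds]
    intro ε hε
    have hpow : Tendsto (fun n : ℕ => ρ ^ n * C) atTop (𝓝 0) := by
      simpa using (tendsto_pow_atTop_nhds_zero_of_lt_one (r := ρ) (by linarith)
        (by linarith)).mul_const C
    obtain ⟨n, hn⟩ := (hpow.eventually_lt_const hε).exists
    filter_upwards [iter n] with t ht
    rw [Real.dist_0_eq_abs]
    exact (ht x).trans_lt hn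
  have := (hYx.add (hN x)).add_const (p x)
  simp only [zero_add] at this
  refine this.congr fun t => ?_
  simp only [hYdef]
  ring

/-! ### Almost sure convergence of martingale transforms. -/

section MartingaleTransform

variable {Ω : Type*} {m : MeasurableSpace Ω} {μ : Measure Ω} [IsProbabilityMeasure μ]
  {ℱ : Filtration ℕ m} {c ξ : ℕ → Ω → ℝ}

/-- The series of a martingale transform converges almost surely if the squares of the coefficients
have bounded sums. -/
theorem ae_exists_tendsto_sum_mul_of_sum_sq_le {K : ℝ}
    (hc : ∀ t, Measurable[ℱ t] (c t)) (hξ : ∀ t, Measurable[ℱ (t + 1)] (ξ t))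
    (hξ₁ : ∀ t ω, |ξ t ω| ≤ 1) (hcξ : ∀ t, c t * μ[ξ t | ℱ t] =ᵐ[μ] 0)
    (hK : ∀ n ω, ∑ t ∈ Finset.range n, c t ω ^ 2 ≤ K) :
    ∀ᵐ ω ∂μ, ∃ l, Tendsto (fun n => ∑ t ∈ Finset.range n, c t ω * ξ t ω) atTop (𝓝 l) := by
  set M : ℕ → Ω → ℝ := fun n ω => ∑ t ∈ Finset.range n, c t ω * ξ t ω with hM
  have hK0 : 0 ≤ K := by
    obtain ⟨ω⟩ := nonempty_of_isProbabilityMeasure μ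
    simpa using hK 0 ω
  have hcb : ∀ t ω, |c t ω| ≤ K + 1 := fun t ω => by
    have h1 : c t ω ^ 2 ≤ K :=
      (Finset.single_le_sum (f := fun t => c t ω ^ 2) (fun _ _ => sq_nonneg _)
        (Finset.self_mem_range_succ t)).trans (hK (t + 1) ω)
    have h2 := sq_abs (c t ω)
    nlinarith [sq_nonneg (|c t ω| - 1)]
  have hcξb : ∀ t ω, |c t ω * ξ t ω| ≤ K + 1 := fun t ω => by
    rw [abs_mul]
    simpa using mul_le_mul (hcb t ω) (hξ₁ t ω) (abs_nonneg _) (by linarith)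
  have hMm : ∀ n, Measurable[ℱ n] (M n) := fun n =>
    Finset.measurable_fun_sum _ fun t ht =>
      ((hc t).mono (ℱ.mono (Finset.mem_range.1 ht).le) le_rfl).mul
        ((hξ t).mono (ℱ.mono (Finset.mem_range.1 ht)) le_rfl)
  -- This crude bound serves only integrability; the bound uniform in `n` comes from orthogonality
  -- of the increments (`hcross`).
  have hMb : ∀ n ω, |M n ω| ≤ n * (K + 1) := fun n ω => by
    refine (Finset.abs_sum_le_sum_abs _ _).trans ?_
    have h := Finset.sum_le_card_nsmul (Finset.range n) _ (K + 1) fun t _ => hcξb t ω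
    rwa [Finset.card_range, nsmul_eq_mul] at h
  have int_of_bdd : ∀ (f : Ω → ℝ) (C : ℝ), Measurable f → (∀ ω, |f ω| ≤ C) → Integrable f μ :=
    fun f C hf hC => Integrable.of_bound hf.aestronglyMeasurable C (ae_of_all _ hC)
  have hMi : ∀ n, Integrable (M n) μ := fun n =>
    int_of_bdd _ _ ((hMm n).mono (ℱ.le n) le_rfl) (hMb n)
  have hξi : ∀ t, Integrable (ξ t) μ := fun t =>
    int_of_bdd _ _ ((hξ t).mono (ℱ.le _) le_rfl) (hξ₁ t)
  have hmart : Martingale M ℱ μ := by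
    refine martingale_of_condExp_sub_eq_zero_nat (fun n => (hMm n).stronglyMeasurable) hMi
      fun n => ?_
    have : M (n + 1) - M n = c n * ξ n := by
      ext ω
      simp [hM, Finset.sum_range_succ]
    rw [this]
    exact (condExp_stronglyMeasurable_mul_of_bound (ℱ.le n) (hc n).stronglyMeasurable (hξi n)
      (K + 1) (ae_of_all _ (hcb n))).trans (hcξ n)
  have hcross : ∀ n, ∫ ω, (M n ω * c n ω) * ξ n ω ∂μ = 0 := fun n => by
    have hb : ∀ ω, ‖(M n * c n) ω‖ ≤ n * (K + 1) * (K + 1) := fun ω => by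
      rw [Pi.mul_apply, norm_mul]
      exact mul_le_mul (hMb n ω) (hcb n ω) (abs_nonneg _) (by positivity)
    have h1 := condExp_stronglyMeasurable_mul_of_bound (μ := μ) (ℱ.le n) (f := M n * c n)
      ((hMm n).mul (hc n)).stronglyMeasurable (hξi n) _ (ae_of_all _ hb)
    have h2 : μ[(M n * c n) * ξ n | ℱ n] =ᵐ[μ] 0 := by
      filter_upwards [h1, hcξ n] with ω h1 h2
      rw [h1, mul_assoc, Pi.mul_apply, h2]
      simp
    have h3 := integral_condExp (μ := μ) (f := (M n * c n) * ξ n) (ℱ.le n)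
    rw [integral_congr_ae h2] at h3
    simpa using h3.symm
  have hci : ∀ n, Integrable (fun ω => c n ω ^ 2) μ := fun n =>
    int_of_bdd _ ((K + 1) ^ 2) (((hc n).mono (ℱ.le n) le_rfl).pow_const 2) fun ω => by
      rw [abs_pow]
      exact pow_le_pow_left₀ (abs_nonneg _) (hcb n ω) 2
  have hM2i : ∀ n, Integrable (fun ω => M n ω ^ 2) μ := fun n =>
    int_of_bdd _ ((n * (K + 1)) ^ 2) (((hMm n).mono (ℱ.le n) le_rfl).pow_const 2) fun ω => by
      rw [abs_pow]
      exact pow_le_pow_left₀ (abs_nonneg _) (hMb n ω) 2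
  have hcri : ∀ n, Integrable (fun ω => (M n ω * c n ω) * ξ n ω) μ := fun n =>
    int_of_bdd _ (n * (K + 1) * (K + 1)) (((hMm n).mono (ℱ.le n) le_rfl).mul
      ((hc n).mono (ℱ.le n) le_rfl) |>.mul ((hξ n).mono (ℱ.le _) le_rfl)) fun ω => by
      rw [mul_assoc, abs_mul]
      exact mul_le_mul (hMb n ω) (hcξb n ω) (abs_nonneg _) (by positivity)
  have hL2 : ∀ n, ∫ ω, M n ω ^ 2 ∂μ ≤ ∫ ω, ∑ t ∈ Finset.range n, c t ω ^ 2 ∂μ := by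
    intro n
    rw [integral_finsetSum _ fun t _ => hci t]
    induction n with
    | zero => simp [hM]
    | succ n ih =>
      rw [Finset.sum_range_succ]
      have h1 : ∫ ω, M (n + 1) ω ^ 2 ∂μ ≤
          ∫ ω, (M n ω ^ 2 + 2 * ((M n ω * c n ω) * ξ n ω)) + c n ω ^ 2 ∂μ := by
        refine integral_mono (hM2i (n + 1)) (((hM2i n).add ((hcri n).const_mul 2)).add (hci n))
          fun ω => ?_
        have h2 : ξ n ω ^ 2 ≤ 1 := (sq_le_one_iff_abs_le_one _).2 (hξ₁ n ω)
        have h3 : M (n + 1) ω = M n ω + c n ω * ξ n ω := Finset.sum_range_succ _ _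
        have h4 := mul_le_mul_of_nonneg_left h2 (sq_nonneg (c n ω))
        simp only [h3]
        linarith [h4]
      have h5 := integral_add ((hM2i n).add ((hcri n).const_mul 2)) (hci n)
      simp only [Pi.add_apply] at h5
      rw [h5, integral_add (hM2i n) ((hcri n).const_mul 2), integral_const_mul, hcross] at h1
      linarith
  have hL1 : ∀ n, ∫ ω, ‖M n ω‖ ∂μ ≤ K + 1 := by
    intro n
    have h1 : ∫ ω, ‖M n ω‖ ∂μ ≤ ∫ ω, M n ω ^ 2 + 1 ∂μ := by
      refine integral_mono (hMi n).norm ((hM2i n).add (integrable_const 1)) fun ω => ?_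
      simp only [Real.norm_eq_abs]
      nlinarith [sq_abs (M n ω), sq_nonneg (|M n ω| - 1)]
    rw [integral_add (hM2i n) (integrable_const 1)] at h1
    have h2 : ∫ ω, ∑ t ∈ Finset.range n, c t ω ^ 2 ∂μ ≤ ∫ _, K ∂μ :=
      integral_mono (integrable_finsetSum _ fun t _ => hci t) (integrable_const K) (hK n)
    simp only [integral_const, probReal_univ, smul_eq_mul, one_mul] at h1 h2
    linarith [hL2 n]
  refine hmart.submartingale.exists_ae_tendsto_of_bdd (R := (K + 1).toNNReal) fun n => ?_
  rw [eLpNorm_one_eq_lintegral_enorm, ← ofReal_integral_norm_eq_lintegral_enorm (hMi n)]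
  exact ENNReal.ofReal_le_ofReal (hL1 n)

/-- The series of a martingale transform converges almost surely if the coefficients are almost
surely square summable. -/
theorem ae_exists_tendsto_sum_mul
    (hc : ∀ t, Measurable[ℱ t] (c t)) (hξ : ∀ t, Measurable[ℱ (t + 1)] (ξ t))
    (hξ₁ : ∀ t ω, |ξ t ω| ≤ 1) (hcξ : ∀ t, c t * μ[ξ t | ℱ t] =ᵐ[μ] 0)
    (hsq : ∀ᵐ ω ∂μ, Summable fun t => c t ω ^ 2) :
    ∀ᵐ ω ∂μ, ∃ l, Tendsto (fun n => ∑ t ∈ Finset.range n, c t ω * ξ t ω) atTop (𝓝 l) := by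
  classical
  -- Localization: the sum includes index `t`, so no jump overshoots `K`, and the cutoff is still `ℱ
  -- t`-measurable. On paths with total at most `K` nothing is cut.
  set d : ℕ → ℕ → Ω → ℝ := fun K t ω =>
    if ∑ i ∈ Finset.range (t + 1), c i ω ^ 2 ≤ K then c t ω else 0 with hd
  have hdm : ∀ K t, Measurable[ℱ t] (d K t) := fun K t => by
    refine Measurable.ite (measurableSet_le ?_ measurable_const) (hc t) measurable_const
    exact Finset.measurable_fun_sum _ fun i hi =>
      ((hc i).mono (ℱ.mono (Nat.lt_succ_iff.1 (Finset.mem_range.1 hi))) le_rfl).pow_const 2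
  have hdK : ∀ (K n : ℕ) ω, ∑ t ∈ Finset.range n, d K t ω ^ 2 ≤ K := by
    intro K n ω
    -- The comparison with the uncut sum closes the induction when a term is kept.
    suffices ∑ t ∈ Finset.range n, d K t ω ^ 2 ≤ K ∧
        ∑ t ∈ Finset.range n, d K t ω ^ 2 ≤ ∑ t ∈ Finset.range n, c t ω ^ 2 from this.1
    induction n with
    | zero => simp
    | succ n ih =>
      by_cases h : ∑ i ∈ Finset.range (n + 1), c i ω ^ 2 ≤ K
      · have h1 : d K n ω = c n ω := if_pos h
        rw [Finset.sum_range_succ _ n, h1]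
        rw [Finset.sum_range_succ] at h ⊢
        constructor <;> linarith [ih.2]
      · have h1 : d K n ω = 0 := if_neg h
        rw [Finset.sum_range_succ _ n, Finset.sum_range_succ _ n, h1]
        constructor <;> nlinarith [ih.1, ih.2, sq_nonneg (c n ω)]
  have hconv : ∀ᵐ ω ∂μ, ∀ K : ℕ, ∃ l,
      Tendsto (fun n => ∑ t ∈ Finset.range n, d K t ω * ξ t ω) atTop (𝓝 l) :=
    ae_all_iff.2 fun K => ae_exists_tendsto_sum_mul_of_sum_sq_le (hdm K) hξ hξ₁
      (fun t => by
        filter_upwards [hcξ t] with ω h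
        simp only [Pi.mul_apply, Pi.zero_apply, hd] at h ⊢
        split_ifs <;> simp [h]) (hdK K)
  filter_upwards [hconv, hsq] with ω h1 h2
  obtain ⟨K, hK⟩ := exists_nat_ge (∑' t, c t ω ^ 2)
  obtain ⟨l, hl⟩ := h1 K
  refine ⟨l, hl.congr fun n => Finset.sum_congr rfl fun t _ => ?_⟩
  have : d K t ω = c t ω := if_pos ((h2.sum_le_tsum _ fun _ _ => sq_nonneg _).trans hK)
  rw [this]

end MartingaleTransform

/-! ### Q-learning for a single agent. -/

section SingleAgent

variable {S A : Type*} [Fintype S] [Fintype A]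

theorem abs_ciSup_sub_ciSup_le [Nonempty A] {f g : A → ℝ} {c : ℝ} (h : ∀ a, |f a - g a| ≤ c) :
    |(⨆ a, f a) - ⨆ a, g a| ≤ c := by
  have hf : BddAbove (Set.range f) := Set.finite_range f |>.bddAbove
  have hg : BddAbove (Set.range g) := Set.finite_range g |>.bddAbove
  have h1 : ⨆ a, f a ≤ (⨆ a, g a) + c := ciSup_le fun a => by
    linarith [le_ciSup hg a, (abs_le.1 (h a)).2]
  have h2 : ⨆ a, g a ≤ (⨆ a, f a) + c := ciSup_le fun a => by
    linarith [le_ciSup hf a, (abs_le.1 (h a)).1]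
  exact abs_le.2 ⟨by linarith, by linarith⟩

theorem abs_ciSup_le [Nonempty A] {f : A → ℝ} {c : ℝ} (h : ∀ a, |f a| ≤ c) :
    |⨆ a, f a| ≤ c := by
  simpa using abs_ciSup_sub_ciSup_le (f := f) (g := fun _ => 0) (by simpa using h)

/-- The Bellman optimality operator on action values of a Markov decision process. -/
noncomputable def bellmanOperator (r : S → A → ℝ) (P : S → A → S → ℝ) (γ : ℝ) (q : S → A → ℝ) :
    S → A → ℝ :=
  fun x a => r x a + γ * ∑ x', P x a x' * ⨆ a', q x' a'

theorem abs_bellmanOperator_sub_le [Nonempty A] {r : S → A → ℝ} {P : S → A → S → ℝ} {γ c : ℝ}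
    (hP₀ : ∀ x a x', 0 ≤ P x a x') (hP₁ : ∀ x a, ∑ x', P x a x' = 1) (hγ : 0 ≤ γ)
    {q q' : S → A → ℝ} (h : ∀ x a, |q x a - q' x a| ≤ c) (x : S) (a : A) :
    |bellmanOperator r P γ q x a - bellmanOperator r P γ q' x a| ≤ γ * c := by
  have h1 : bellmanOperator r P γ q x a - bellmanOperator r P γ q' x a =
      γ * ∑ x', P x a x' * ((⨆ a', q x' a') - ⨆ a', q' x' a') := by
    simp only [bellmanOperator, mul_sub, Finset.sum_sub_distrib]
    ring
  rw [h1, abs_mul, abs_of_nonneg hγ]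
  refine mul_le_mul_of_nonneg_left ((Finset.abs_sum_le_sum_abs _ _).trans ?_) hγ
  calc ∑ x', |P x a x' * ((⨆ a', q x' a') - ⨆ a', q' x' a')| ≤ ∑ x', P x a x' * c :=
        Finset.sum_le_sum fun x' _ => by
          rw [abs_mul, abs_of_nonneg (hP₀ x a x')]
          exact mul_le_mul_of_nonneg_left (abs_ciSup_sub_ciSup_le (h x')) (hP₀ x a x')
    _ = c := by rw [← Finset.sum_mul, hP₁, one_mul]

theorem exists_bellmanOperator_eq_self [Nonempty A] (r : S → A → ℝ) {P : S → A → S → ℝ} {γ : ℝ}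
    (hP₀ : ∀ x a x', 0 ≤ P x a x') (hP₁ : ∀ x a, ∑ x', P x a x' = 1) (hγ : 0 ≤ γ) (hγ₁ : γ < 1) :
    ∃ q, bellmanOperator r P γ q = q := by
  have hc : ContractingWith ⟨γ, hγ⟩ (bellmanOperator r P γ) := by
    refine ⟨hγ₁, LipschitzWith.of_dist_le_mul fun q q' => ?_⟩
    have h : ∀ x a, |q x a - q' x a| ≤ dist q q' := fun x a => by
      rw [← Real.dist_eq]
      exact (dist_le_pi_dist _ _ a).trans (dist_le_pi_dist _ _ x)
    have h0 : 0 ≤ γ * dist q q' := mul_nonneg hγ dist_nonneg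
    refine (dist_pi_le_iff h0).2 fun x => (dist_pi_le_iff h0).2 fun a => ?_
    rw [Real.dist_eq]
    exact abs_bellmanOperator_sub_le hP₀ hP₁ hγ h x a
  exact ⟨_, hc.fixedPoint_isFixedPt⟩

/-- Tabular Q-learning along the states `s` with learning rates `α`. -/
noncomputable def qLearning (r : S → A → ℝ) (γ : ℝ) (s : ℕ → S) (α : ℕ → S → A → ℝ)
    (q₀ : S → A → ℝ) : ℕ → S → A → ℝ
  | 0 => q₀
  | t + 1 => fun x a => (1 - α t x a) * qLearning r γ s α q₀ t x a +
      α t x a * (r x a + γ * ⨆ a', qLearning r γ s α q₀ t (s (t + 1)) a')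

/-- The radius `C + R / (1 - γ)` is preserved because `R + γ * (C + R / (1 - γ)) ≤ C + R / (1 - γ)`,
and the update is a convex combination. -/
theorem exists_abs_qLearning_le [Nonempty A] {r : S → A → ℝ} {γ : ℝ} {s : ℕ → S}
    {α : ℕ → S → A → ℝ} {q₀ : S → A → ℝ} (hγ : 0 ≤ γ) (hγ₁ : γ < 1)
    (hα₀ : ∀ t x a, 0 ≤ α t x a) (hα₁ : ∀ t x a, α t x a ≤ 1) :
    ∃ B, ∀ t x a, |qLearning r γ s α q₀ t x a| ≤ B := by
  have single : ∀ (f : S → A → ℝ) x a, |f x a| ≤ ∑ x, ∑ a, |f x a| := fun f x a =>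
    (Finset.single_le_sum (f := fun a => |f x a|) (fun _ _ => abs_nonneg _)
      (Finset.mem_univ a)).trans
    (Finset.single_le_sum (f := fun x => ∑ a, |f x a|)
      (fun _ _ => Finset.sum_nonneg fun _ _ => abs_nonneg _) (Finset.mem_univ x))
  set R := ∑ x, ∑ a, |r x a|
  set C := ∑ x, ∑ a, |q₀ x a|
  have hR : 0 ≤ R := Finset.sum_nonneg fun _ _ => Finset.sum_nonneg fun _ _ => abs_nonneg _
  have hC : 0 ≤ C := Finset.sum_nonneg fun _ _ => Finset.sum_nonneg fun _ _ => abs_nonneg _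
  have hdiv : R / (1 - γ) * (1 - γ) = R := div_mul_cancel₀ _ (by linarith)
  have hdiv₀ : 0 ≤ R / (1 - γ) := div_nonneg hR (by linarith)
  refine ⟨C + R / (1 - γ), fun t => ?_⟩
  induction t with
  | zero => exact fun x a => (single q₀ x a).trans (by linarith)
  | succ t ih =>
    intro x a
    have h1 : |r x a + γ * ⨆ a', qLearning r γ s α q₀ t (s (t + 1)) a'| ≤ C + R / (1 - γ) := by
      refine (abs_add_le _ _).trans ?_
      rw [abs_mul, abs_of_nonneg hγ]
      have h2 := mul_le_mul_of_nonneg_left (abs_ciSup_le (ih (s (t + 1)))) hγ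
      have h3 : γ * C ≤ 1 * C := mul_le_mul_of_nonneg_right hγ₁.le hC
      linarith [single r x a]
    rw [qLearning]
    refine (abs_add_le _ _).trans ?_
    rw [abs_mul, abs_mul, abs_of_nonneg (hα₀ t x a), abs_of_nonneg (sub_nonneg.2 (hα₁ t x a))]
    have h4 := mul_le_mul_of_nonneg_left h1 (hα₀ t x a)
    have h5 := mul_le_mul_of_nonneg_left (ih x a) (sub_nonneg.2 (hα₁ t x a))
    linarith

variable {Ω : Type*} {m : MeasurableSpace Ω} {ℱ : Filtration ℕ m}

theorem measurable_qLearning {r : S → A → ℝ} {γ : ℝ} {s : ℕ → Ω → S} {α : ℕ → Ω → S → A → ℝ}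
    {q₀ : Ω → S → A → ℝ} (hs : ∀ t x, MeasurableSet[ℱ t] {ω | s t ω = x})
    (hα : ∀ t x a, Measurable[ℱ t] fun ω => α t ω x a)
    (hq₀ : ∀ x a, Measurable[ℱ 0] fun ω => q₀ ω x a) (t : ℕ) (x : S) (a : A) :
    Measurable[ℱ t] fun ω => qLearning r γ (s · ω) (α · ω) (q₀ ω) t x a := by
  classical
  induction t generalizing x a with
  | zero => exact hq₀ x a
  | succ t ih =>
    have hq : ∀ x a, Measurable[ℱ (t + 1)]
        fun ω => qLearning r γ (s · ω) (α · ω) (q₀ ω) t x a := fun x a =>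
      (ih x a).mono (ℱ.mono t.le_succ) le_rfl
    have hα' : Measurable[ℱ (t + 1)] fun ω => α t ω x a :=
      (hα t x a).mono (ℱ.mono t.le_succ) le_rfl
    have hV : Measurable[ℱ (t + 1)]
        fun ω => ⨆ a', qLearning r γ (s · ω) (α · ω) (q₀ ω) t (s (t + 1) ω) a' := by
      -- `S` carries no σ-algebra, so the random index is resolved over the events `s (t + 1) ω =
      -- x'`.
      have h1 : (fun ω => ⨆ a', qLearning r γ (s · ω) (α · ω) (q₀ ω) t (s (t + 1) ω) a') =
          fun ω => ∑ x', if s (t + 1) ω = x' then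
            ⨆ a', qLearning r γ (s · ω) (α · ω) (q₀ ω) t x' a' else 0 := by
        ext ω
        simp
      rw [h1]
      exact Finset.measurable_fun_sum _ fun x' _ =>
        Measurable.ite (hs (t + 1) x') (Measurable.iSup (hq x')) measurable_const
    exact ((measurable_const.sub hα').mul (hq x a)).add
      (hα'.mul (measurable_const.add (measurable_const.mul hV)))

/-- Almost sure convergence of Q-learning to a solution of the Bellman optimality equation. -/
theorem tendsto_qLearning [Nonempty A] {μ : Measure Ω} [IsProbabilityMeasure μ]
    {r : S → A → ℝ} {P : S → A → S → ℝ} {γ : ℝ}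
    {s : ℕ → Ω → S} {u : ℕ → Ω → A} {α : ℕ → Ω → S → A → ℝ} {q₀ : Ω → S → A → ℝ} {p : S → A → ℝ}
    (hP₀ : ∀ x a x', 0 ≤ P x a x') (hP₁ : ∀ x a, ∑ x', P x a x' = 1) (hγ : 0 ≤ γ) (hγ₁ : γ < 1)
    (hp : bellmanOperator r P γ p = p)
    (hs : ∀ t x, MeasurableSet[ℱ t] {ω | s t ω = x})
    (htrans : ∀ t x', μ[Set.indicator {ω | s (t + 1) ω = x'} (fun _ => (1 : ℝ)) | ℱ t] =ᵐ[μ]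
      fun ω => P (s t ω) (u t ω) x')
    (hα : ∀ t x a, Measurable[ℱ t] fun ω => α t ω x a)
    (hα₀ : ∀ t ω x a, 0 ≤ α t ω x a) (hα₁ : ∀ t ω x a, α t ω x a ≤ 1)
    (hsum : ∀ᵐ ω ∂μ, ∀ x a, Tendsto (fun n => ∑ t ∈ Finset.range n, α t ω x a) atTop atTop)
    (hsq : ∀ᵐ ω ∂μ, ∀ x a, Summable fun t => α t ω x a ^ 2)
    (hzero : ∀ t ω x a, (x, a) ≠ (s t ω, u t ω) → α t ω x a = 0)
    (hq₀ : ∀ x a, Measurable[ℱ 0] fun ω => q₀ ω x a) :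
    ∀ᵐ ω ∂μ, Tendsto (qLearning r γ (s · ω) (α · ω) (q₀ ω)) atTop (𝓝 p) := by
  classical
  set q : ℕ → Ω → S → A → ℝ := fun t ω => qLearning r γ (s · ω) (α · ω) (q₀ ω) t with hq
  set V : ℕ → Ω → S → ℝ := fun t ω x => ⨆ a, q t ω x a with hV
  -- The noise is split by next state: `ξ` is bounded by one, while `V`, bounded only path by path,
  -- goes into the coefficient.
  set ξ : S → A → S → ℕ → Ω → ℝ := fun x a x' t ω =>
    Set.indicator {ω | s (t + 1) ω = x'} (fun _ => (1 : ℝ)) ω - P x a x' with hξ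
  have hbdd : ∀ ω, ∃ B, ∀ t x a, |q t ω x a| ≤ B := fun ω =>
    exists_abs_qLearning_le hγ hγ₁ (fun t => hα₀ t ω) (fun t => hα₁ t ω)
  have hP_le : ∀ x a x', P x a x' ≤ 1 := fun x a x' =>
    (Finset.single_le_sum (fun y _ => hP₀ x a y) (Finset.mem_univ x')).trans_eq (hP₁ x a)
  have hnoise : ∀ᵐ ω ∂μ, ∀ x a x', ∃ l, Tendsto
      (fun n => ∑ t ∈ Finset.range n, (α t ω x a * V t ω x') * ξ x a x' t ω) atTop (𝓝 l) := by
    refine ae_all_iff.2 fun x => ae_all_iff.2 fun a => ae_all_iff.2 fun x' => ?_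
    refine ae_exists_tendsto_sum_mul (ℱ := ℱ) (c := fun t ω => α t ω x a * V t ω x')
      (ξ := ξ x a x') (fun t => ?_) (fun t => ?_) (fun t ω => ?_) (fun t => ?_) ?_
    · exact (hα t x a).mul (Measurable.iSup fun a' => measurable_qLearning hs hα hq₀ t x' a')
    · exact (measurable_const.indicator (hs (t + 1) x')).sub measurable_const
    · have h1 := hP₀ x a x'
      have h2 := hP_le x a x'
      simp only [hξ, Set.indicator_apply]
      split_ifs <;> rw [abs_le] <;> constructor <;> linarith
    · have hi : Integrable (Set.indicator {ω | s (t + 1) ω = x'} (fun _ => (1 : ℝ))) μ :=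
        (integrable_const 1).indicator (ℱ.le _ _ (hs (t + 1) x'))
      have h1 : μ[ξ x a x' t | ℱ t] =ᵐ[μ] _ :=
        condExp_sub hi (integrable_const (P x a x')) (ℱ t)
      rw [condExp_const (ℱ.le t)] at h1
      filter_upwards [h1, htrans t x'] with ω h1 h2
      simp only [Pi.mul_apply, h1, Pi.sub_apply, h2, Pi.zero_apply]
      -- `ξ` is centred only at the visited pair; elsewhere the learning rate vanishes.
      by_cases h : (x, a) = (s t ω, u t ω)
      · obtain ⟨rfl, rfl⟩ := Prod.mk.inj h
        simp
      · simp [hzero t ω x a h]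
    · filter_upwards [hsq] with ω h
      obtain ⟨B, hB⟩ := hbdd ω
      refine Summable.of_nonneg_of_le (fun _ => sq_nonneg _) (fun t => ?_)
        ((h x a).mul_right (B ^ 2))
      rw [mul_pow]
      refine mul_le_mul_of_nonneg_left ?_ (sq_nonneg _)
      rw [← sq_abs]
      exact pow_le_pow_left₀ (abs_nonneg _) (abs_ciSup_le (hB t x')) 2
  filter_upwards [hnoise, hsum] with ω h1 h2
  obtain ⟨B, hB⟩ := hbdd ω
  have key : Tendsto (fun t (z : S × A) => q t ω z.1 z.2) atTop (𝓝 fun z => p z.1 z.2) := by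
    refine tendsto_of_asynchronous_contraction
      (H := fun v z => bellmanOperator r P γ (fun x a => v (x, a)) z.1 z.2)
      (α := fun t z => α t ω z.1 z.2)
      (w := fun t z => γ * ∑ x', V t ω x' * ξ z.1 z.2 x' t ω) hγ hγ₁ (fun v c hv z => ?_)
      (fun t z => hα₀ t ω _ _) (fun t z => hα₁ t ω _ _) (fun z => h2 _ _) (fun t z => ?_)
      (fun t z => hB t _ _) fun z => ?_
    · have h := abs_bellmanOperator_sub_le (r := r) hP₀ hP₁ hγ (q := fun x a => v (x, a)) (q' := p)
        (fun x a => hv (x, a)) z.1 z.2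
      rwa [hp] at h
    · have h3 : ∑ x', V t ω x' * ξ z.1 z.2 x' t ω =
          V t ω (s (t + 1) ω) - ∑ x', P z.1 z.2 x' * V t ω x' := by
        simp only [hξ, Set.indicator_apply, Set.mem_ofPred_eq, mul_sub, Finset.sum_sub_distrib,
          mul_ite, mul_one, mul_zero, Finset.sum_ite_eq, Finset.mem_univ, if_true,
          mul_comm (V t ω _) (P _ _ _)]
      have h4 : q (t + 1) ω z.1 z.2 = (1 - α t ω z.1 z.2) * q t ω z.1 z.2 +
          α t ω z.1 z.2 * (r z.1 z.2 + γ * V t ω (s (t + 1) ω)) := rfl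
      have h5 : bellmanOperator r P γ (fun x a => q t ω x a) z.1 z.2 =
          r z.1 z.2 + γ * ∑ x', P z.1 z.2 x' * V t ω x' := rfl
      simp only [h3, h4, h5]
      ring
    · choose l hl using h1 z.1 z.2
      refine ⟨γ * ∑ x', l x', ((tendsto_finsetSum _ fun x' _ => hl x').const_mul γ).congr
        fun n => ?_⟩
      rw [Finset.sum_comm, Finset.mul_sum]
      refine Finset.sum_congr rfl fun t _ => ?_
      simp only [Finset.mul_sum]
      exact Finset.sum_congr rfl fun x' _ => by ring
  rw [tendsto_pi_nhds] at key ⊢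
  exact fun x => tendsto_pi_nhds.2 fun a => key (x, a)

end SingleAgent

/-! ### Global optimal points of stage games. -/

section StageGame

variable {A₁ A₂ : Type*} {u : Fin 2 → A₁ → A₂ → ℝ} {y : A₁} {z : A₂}

/-- Any best response map remains one when redirected at `y` to `z`, and no reply can give the
leader more than `(y, z)` does. -/
theorem IsGlobalOptimal.isStackelberg [Finite A₂] (h : IsGlobalOptimal u y z) :
    IsStackelberg (u 0) (u 1) y z := by
  classical
  have : Nonempty A₂ := ⟨z⟩
  choose b hb using fun a => Finite.exists_max (u 1 a)
  refine ⟨Function.update b y z, fun a a' => ?_, fun a => ?_, Function.update_self ..⟩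
  · by_cases ha : a = y
    · subst ha
      simpa using h 1 a a'
    · simpa [ha] using hb a a'
  · simpa only [Function.update_self] using h 0 a _

theorem IsGlobalOptimal.eq_ciSup (h : IsGlobalOptimal u y z) (k : Fin 2) :
    u k y z = ⨆ a : A₁ × A₂, u k a.1 a.2 := by
  have : Nonempty (A₁ × A₂) := ⟨(y, z)⟩
  refine le_antisymm (le_ciSup (f := fun a : A₁ × A₂ => u k a.1 a.2) ⟨u k y z, ?_⟩ (y, z))
    (ciSup_le fun a => h k _ _)
  rintro _ ⟨a, rfl⟩
  exact h k _ _

/-- By pigeonhole one fixed joint action is optimal for infinitely many `t`, and its inequalities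
pass to the limit. -/
theorem exists_isGlobalOptimal_of_tendsto [Finite A₁] [Finite A₂]
    {v : ℕ → Fin 2 → A₁ → A₂ → ℝ} (hv : Tendsto v atTop (𝓝 u))
    (h : ∀ t, ∃ y z, IsGlobalOptimal (v t) y z) : ∃ y z, IsGlobalOptimal u y z := by
  obtain ⟨a, ha⟩ : ∃ a : A₁ × A₂, ∃ᶠ t in atTop, IsGlobalOptimal (v t) a.1 a.2 := by
    by_contra! hcon
    obtain ⟨t, ht⟩ := (eventually_all.2 hcon).exists
    obtain ⟨y, z, hyz⟩ := h t
    exact ht (y, z) hyz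
  refine ⟨a.1, a.2, fun k y z => ?_⟩
  have hlim : ∀ y z, Tendsto (fun t => v t k y z) atTop (𝓝 (u k y z)) := fun y z =>
    tendsto_pi_nhds.1 (tendsto_pi_nhds.1 (tendsto_pi_nhds.1 hv k) y) z
  by_contra! hlt
  obtain ⟨t, h1, h2⟩ := (ha.and_eventually ((hlim _ _).eventually_lt (hlim _ _) hlt)).exists
  exact absurd (h1 k y z) (not_le.2 h2)

end StageGame

/-! ### Reduction of bi-level learning to single-agent learning. -/

theorem mainTheorem1 {S A₁ A₂ Ω : Type*} [Fintype S] [Fintype A₁] [Fintype A₂]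
    {m : MeasurableSpace Ω} (μ : Measure Ω) [IsProbabilityMeasure μ] (ℱ : Filtration ℕ m)
    (G : MarkovGame S A₁ A₂)
    (s : ℕ → Ω → S) (a₁ : ℕ → Ω → A₁) (a₂ : ℕ → Ω → A₂)
    (α : ℕ → Ω → S → A₁ → A₂ → ℝ)
    (b₁ : ℕ → Ω → A₁) (b₂ : ℕ → Ω → A₂) (Q : ℕ → Ω → QPair S A₁ A₂)
    (hplay : IsPlay G μ ℱ s a₁ a₂)
    (hrun : IsBilevelQRun G ℱ s α b₁ b₂ Q)
    (hvisit : VisitedInfinitelyOften μ s a₁ a₂)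
    (hrate : IsLearningRate μ ℱ s a₁ a₂ α)
    (hopt : SelectsGlobalOptimum μ s b₁ b₂ Q) :
    ∃ Qstar : QPair S A₁ A₂, SolvesBilevelBellman G Qstar ∧
      ∀ᵐ ω ∂μ, Tendsto (fun t => Q t ω) atTop (𝓝 Qstar) := by
  obtain ⟨ω₀⟩ := nonempty_of_isProbabilityMeasure μ
  have : Nonempty (A₁ × A₂) := ⟨(a₁ 0 ω₀, a₂ 0 ω₀)⟩
  set r : Fin 2 → S → A₁ × A₂ → ℝ := fun k x a => G.reward k x a.1 a.2 with hr
  set P : S → A₁ × A₂ → S → ℝ := fun x a => G.trans x a.1 a.2 with hP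
  have hP₀ : ∀ x a x', 0 ≤ P x a x' := fun _ _ _ => G.trans_nonneg _ _ _ _
  have hP₁ : ∀ x a, ∑ x', P x a x' = 1 := fun _ _ => G.trans_sum _ _ _
  set α' : ℕ → Ω → S → A₁ × A₂ → ℝ := fun t ω x a => α t ω x a.1 a.2 with hα'
  set q₀ : Fin 2 → Ω → S → A₁ × A₂ → ℝ := fun k ω x a => Q 0 ω k x a.1 a.2 with hq₀
  choose p hp using fun k => exists_bellmanOperator_eq_self (r k) hP₀ hP₁ G.γ_nonneg G.γ_lt_one
  have hlearn : ∀ᵐ ω ∂μ, ∀ k,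
      Tendsto (qLearning (r k) G.γ (s · ω) (α' · ω) (q₀ k ω)) atTop (𝓝 (p k)) := by
    refine ae_all_iff.2 fun k => tendsto_qLearning (u := fun t ω => (a₁ t ω, a₂ t ω)) hP₀ hP₁
      G.γ_nonneg G.γ_lt_one (hp k) hplay.state_adapted hplay.transition
      (fun t x a => hrate.adapted t x _ _) (fun t ω x a => hrate.nonneg t ω x _ _)
      (fun t ω x a => (hrate.lt_one t ω x _ _).le) ?_ ?_
      (fun t ω x a h => hrate.eq_zero t ω x _ _ h) fun x a => hrun.initial k x _ _
    · filter_upwards [hrate.sum_eq_top] with ω h x a using h x _ _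
    · filter_upwards [hrate.sum_sq_lt_top] with ω h x a using h x _ _
  have hQ : ∀ᵐ ω ∂μ, ∀ t k x (a : A₁ × A₂), Q t ω k x a.1 a.2 =
      qLearning (r k) G.γ (s · ω) (α' · ω) (q₀ k ω) t x a := by
    filter_upwards [hopt] with ω h t
    induction t with
    | zero => exact fun _ _ _ => rfl
    | succ t ih =>
      intro k x a
      obtain ⟨-, y, z, hyz, hb⟩ := h t
      rw [hrun.update, hb k, hyz.eq_ciSup k, qLearning]
      simp only [ih, hα', hr]
  set Qstar : QPair S A₁ A₂ := fun k x y z => p k x (y, z) with hQstar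
  have hconv : ∀ᵐ ω ∂μ, Tendsto (fun t => Q t ω) atTop (𝓝 Qstar) := by
    filter_upwards [hlearn, hQ] with ω h1 h2
    refine tendsto_pi_nhds.2 fun k => tendsto_pi_nhds.2 fun x => tendsto_pi_nhds.2 fun y =>
      tendsto_pi_nhds.2 fun z => ?_
    exact (tendsto_pi_nhds.1 (tendsto_pi_nhds.1 (h1 k) x) (y, z)).congr fun t =>
      (h2 t k x (y, z)).symm
  refine ⟨Qstar, ?_, hconv⟩
  -- `Qstar` is not random, so a single good path suffices to find its global optimal points.
  obtain ⟨ω, h1, h2⟩ := (hconv.and hopt).exists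
  have hstar : ∀ x, ∃ y z, IsGlobalOptimal (fun k => Qstar k x) y z := fun x =>
    exists_isGlobalOptimal_of_tendsto (v := fun t k => Q t ω k x)
      (tendsto_pi_nhds.2 fun k => tendsto_pi_nhds.1 (tendsto_pi_nhds.1 h1 k) x) fun t => (h2 t).1 x
  choose π₁ π₂ hπ using hstar
  refine ⟨π₁, π₂, fun x => (hπ x).isStackelberg, fun k x y z => ?_⟩
  have hV : ∀ x', Qstar k x' (π₁ x') (π₂ x') = ⨆ a, p k x' a := fun x' => (hπ x').eq_ciSup k
  simp only [hV]
  exact (congrFun (congrFun (hp k) x) (y, z)).symm
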